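/- All graphs are finite, simple and undirected, and $\chi$ denotes the chromatic number. For a proper colouring $\sigma$ of a graph $G$, let \[ \varphi_\sigma(G) = \max_{H} \bigl(|\sigma(V(H))| - \chi(H)\bigr), \] where $H$ ranges over all induced subgraphs of $G$, and let the chromatic discrepancy of $G$ be $\varphi(G) = \min_\sigma \varphi_\sigma(G)$, where $\sigma$ ranges over all proper colourings of $G$ (with any number of colours). For an integer $t \ge 1$, the graph $G$ is co-locally $t$-colourable if $\chi(G[\{u\} \cup N(v)]) \le t$ for every vertex $v$ of $G$ and every vertex $u \ne v$ of $G$, where $N(v)$ is the set of neighbours of $v$. Theorem. Let $s \ge 3$ be an integer, and let $G$ be a co-locally $(s-1)$-colourable graph that is not isomorphic to the complete graph $K_s$ and satisfies $\chi(G) < \frac{5s+2}{3}$. Then \[ \varphi(G) \ge \chi(G) - s + 1. \] -/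

import Mathlib

namespace ChromaticDiscrepancy

/-- The chromatic number of a finite graph, as a natural number
(Mathlib's `SimpleGraph.chromaticNumber` is finite on finite graphs). -/
noncomputable def chi {V : Type*} [Finite V] (G : SimpleGraph V) : ℕ :=
  G.chromaticNumber.toNat

theorem coe_chi {V : Type*} [Finite V] (G : SimpleGraph V) :
    (chi G : ℕ∞) = G.chromaticNumber :=
  ENat.natCast_toNat (SimpleGraph.chromaticNumber_ne_top_iff_exists.2 (by
    have := Fintype.ofFinite V
    exact ⟨_, G.colorable_of_fintype⟩))

/-- The number of colours spanned by the subgraph of `G` induced by `X`,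
minus the chromatic number of that subgraph. -/
noncomputable def excess {V α : Type*} [Finite V] (G : SimpleGraph V)
    (σ : G.Coloring α) (X : Set V) : ℤ :=
  ((σ '' X).ncard : ℤ) - (chi (G.induce X) : ℤ)

/-- The discrepancy of a proper colouring `σ`: the maximum of `|σ(V(H))| - χ(H)` over all induced
subgraphs `H` of `G`. The maximum exists by `isGreatest_colouringDiscrepancy`. -/
noncomputable def colouringDiscrepancy {V α : Type*} [Finite V] (G : SimpleGraph V)
    (σ : G.Coloring α) : ℤ :=
  ⨆ X : Set V, excess G σ X

/-- The chromatic discrepancy of `G`: the minimum discrepancy over all proper colourings of `G`.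
Colours are taken in `ℕ`, which loses nothing for a finite graph
(`chromaticDiscrepancy_le`); the minimum exists by `isLeast_chromaticDiscrepancy`. -/
noncomputable def chromaticDiscrepancy {V : Type*} [Finite V] (G : SimpleGraph V) : ℤ :=
  ⨅ σ : G.Coloring ℕ, colouringDiscrepancy G σ

/-- `G` is co-locally `s`-colourable: for every vertex `v` and every vertex `u ≠ v`, the subgraph
induced by `{u} ∪ N(v)` has chromatic number at most `s`. -/
def CoLocallyColourable {V : Type*} (G : SimpleGraph V) (s : ℕ) : Prop :=
  ∀ v u : V, u ≠ v → (G.induce ({u} ∪ G.neighborSet v)).chromaticNumber ≤ (s : ℕ∞)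

theorem isGreatest_colouringDiscrepancy {V α : Type*} [Finite V] (G : SimpleGraph V)
    (σ : G.Coloring α) :
    IsGreatest (Set.range fun X : Set V => excess G σ X) (colouringDiscrepancy G σ) := by
  have hf : (Set.range fun X : Set V => excess G σ X).Finite := Set.finite_range _
  have hn : (Set.range fun X : Set V => excess G σ X).Nonempty := Set.range_nonempty _
  exact ⟨hn.csSup_mem hf, fun _ h => le_csSup hf.bddAbove h⟩

theorem colouringDiscrepancy_nonneg {V α : Type*} [Finite V] (G : SimpleGraph V)
    (σ : G.Coloring α) : 0 ≤ colouringDiscrepancy G σ := by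
  refine le_trans ?_ ((isGreatest_colouringDiscrepancy G σ).2 ⟨∅, rfl⟩)
  simp [excess, chi]

theorem isLeast_chromaticDiscrepancy {V : Type*} [Finite V] (G : SimpleGraph V) :
    IsLeast (Set.range fun σ : G.Coloring ℕ => colouringDiscrepancy G σ)
      (chromaticDiscrepancy G) := by
  have hb : BddBelow (Set.range fun σ : G.Coloring ℕ => colouringDiscrepancy G σ) :=
    ⟨0, by rintro _ ⟨σ, rfl⟩; exact colouringDiscrepancy_nonneg G σ⟩
  obtain ⟨f, hf⟩ := Countable.exists_injective_nat V
  have hn : (Set.range fun σ : G.Coloring ℕ => colouringDiscrepancy G σ).Nonempty :=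
    ⟨_, SimpleGraph.Coloring.mk f (fun h e => h.ne (hf e)), rfl⟩
  exact ⟨Int.csInf_mem hn hb, fun _ h => csInf_le hb h⟩

theorem chromaticDiscrepancy_le {V α : Type*} [Finite V] (G : SimpleGraph V)
    (σ : G.Coloring α) : chromaticDiscrepancy G ≤ colouringDiscrepancy G σ := by
  obtain ⟨f, hf⟩ := Countable.exists_injective_nat (Set.range σ)
  let τ : G.Coloring ℕ := SimpleGraph.Coloring.mk (fun v => f ⟨σ v, v, rfl⟩) (fun h e =>
    σ.valid h (congrArg Subtype.val (hf e)))
  refine le_trans ((isLeast_chromaticDiscrepancy G).2 ⟨τ, rfl⟩) (le_of_eq ?_)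
  refine iSup_congr fun X => ?_
  have h1 : τ '' X = f '' ((fun v => (⟨σ v, v, rfl⟩ : Set.range σ)) '' X) := by
    rw [Set.image_image]; rfl
  have h2 : σ '' X = Subtype.val '' ((fun v => (⟨σ v, v, rfl⟩ : Set.range σ)) '' X) := by
    rw [Set.image_image]
  unfold excess
  rw [h1, h2, Set.ncard_image_of_injective _ hf,
    Set.ncard_image_of_injective _ Subtype.val_injective]

end ChromaticDiscrepancy

namespace ChromaticDiscrepancy

/-! Suppose an optimal colouring `σ`, with colour set `R`, has discrepancy at most `χ(G) - s`. Then
every transversal `T` of the colour classes satisfies `χ(T) ≥ s + (|R| - χ(G))`.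

If `|R| = χ(G)`, each colour class contains a vertex `w` seeing all other colours. A second vertex
`u` in that class would complete a transversal inside `{u} ∪ N(w)`, whose chromatic number is below
`s`. So all classes are singletons, `G` is complete, and the bounds on its order leave only `K_s`
(`injective_and_eq_top_of_card_eq`).

If `|R| > χ(G)`, then `χ(G) < (5s + 2)/3` gives `3|T| < 5χ(T)`. For such a `T` some `v` has `χ(N(v))
≥ χ(T) - 1 ≥ s` (`exists_chiOn_le_chiOn_neighborSet_add_one`), against co-local colourability. That
lemma splits `T` repeatedly into joins by Gallai's theorem on `k`-chromatic graphs with at most `2k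
- 2` vertices (`exists_join_of_card_add_two_le`), which comes from Tutte's theorem in the complement
together with Hall's theorem. -/

open Finset

/-! ### Chromatic numbers of induced subgraphs. -/

section Basics

variable {V : Type*} {G : SimpleGraph V}

/-- `c` is a proper colouring of the subgraph of `G` induced by `S`. -/
def ProperOn {α : Type*} (G : SimpleGraph V) (S : Set V) (c : V → α) : Prop :=
  ∀ u ∈ S, ∀ v ∈ S, G.Adj u v → c u ≠ c v

theorem ProperOn.mono {α : Type*} {S T : Set V} {c : V → α} (h : ProperOn G T c) (hST : S ⊆ T) :
    ProperOn G S c :=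
  fun u hu v hv => h u (hST hu) v (hST hv)

variable [Finite V]

/-- The chromatic number of the subgraph of `G` induced by `S`. -/
noncomputable def chiOn (G : SimpleGraph V) (S : Set V) : ℕ := chi (G.induce S)

theorem chi_le_iff {n : ℕ} : chi G ≤ n ↔ G.Colorable n := by
  rw [← SimpleGraph.chromaticNumber_le_iff_colorable, ← coe_chi, Nat.cast_le]

theorem chiOn_le_of_properOn {α : Type*} {S : Set V} {c : V → α} {T : Finset α}
    (hc : ProperOn G S c) (hT : ∀ v ∈ S, c v ∈ T) : chiOn G S ≤ #T := by
  refine chi_le_iff.2 ?_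
  have C : (G.induce S).Coloring T :=
    SimpleGraph.Coloring.mk (fun v => ⟨c v, hT v v.2⟩) fun {u v} h e =>
      hc u u.2 v v.2 h (congrArg Subtype.val e)
  simpa using C.colorable

theorem exists_properOn (G : SimpleGraph V) (S : Set V) :
    ∃ c : V → ℕ, ProperOn G S c ∧ ∀ v ∈ S, c v < chiOn G S := by
  classical
  obtain ⟨C⟩ : (G.induce S).Colorable (chiOn G S) := chi_le_iff.1 le_rfl
  refine ⟨fun v => if h : v ∈ S then C ⟨v, h⟩ else 0, fun u hu v hv h e => ?_, fun v hv => ?_⟩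
  · simp only [hu, hv, dif_pos] at e
    exact C.valid (v := ⟨u, hu⟩) (w := ⟨v, hv⟩) h (Fin.ext e)
  · simp [hv]

theorem chiOn_mono {S T : Set V} (h : S ⊆ T) : chiOn G S ≤ chiOn G T := by
  obtain ⟨c, hc, hlt⟩ := exists_properOn G T
  simpa using chiOn_le_of_properOn (T := Finset.range (chiOn G T)) (hc.mono h)
    fun v hv => by simpa using hlt v (h hv)

theorem chiOn_univ : chiOn G Set.univ = chi G := by
  refine le_antisymm ?_ ?_
  · obtain ⟨C⟩ := chi_le_iff.1 (le_refl (chi G))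
    exact chi_le_iff.2 ⟨C.comp (SimpleGraph.Embedding.induce Set.univ).toHom⟩
  · obtain ⟨C⟩ := chi_le_iff.1 (le_refl (chiOn G Set.univ))
    exact chi_le_iff.2 ⟨C.comp (SimpleGraph.induceUnivIso G).symm.toHom⟩

theorem chiOn_union_le (S T : Set V) : chiOn G (S ∪ T) ≤ chiOn G S + chiOn G T := by
  classical
  obtain ⟨c, hc, hcl⟩ := exists_properOn G S
  obtain ⟨d, hd, hdl⟩ := exists_properOn G T
  have := chiOn_le_of_properOn (G := G) (S := S ∪ T)
    (c := fun v => if v ∈ S then c v else chiOn G S + d v)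
    (T := Finset.range (chiOn G S + chiOn G T)) ?_ ?_
  · simpa using this
  · intro u hu v hv h e
    by_cases hu' : u ∈ S <;> by_cases hv' : v ∈ S <;> simp only [hu', hv', if_true, if_false] at e
    · exact hc u hu' v hv' h e
    · have := hcl u hu'; omega
    · have := hcl v hv'; omega
    · exact hd u (hu.resolve_left hu') v (hv.resolve_left hv') h (by omega)
  · intro v hv
    by_cases hv' : v ∈ S <;> simp only [hv', if_true, if_false, Finset.mem_range]
    · have := hcl v hv'; omega
    · have := hdl v (hv.resolve_left hv'); omega

theorem chiOn_empty : chiOn G ∅ = 0 := by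
  simpa using chiOn_le_of_properOn (G := G) (S := ∅) (c := fun _ => 0) (T := ∅)
    (fun u hu => hu.elim) fun v hv => hv.elim

theorem one_le_chiOn {S : Set V} (h : S.Nonempty) : 1 ≤ chiOn G S := by
  obtain ⟨u, hu⟩ := h
  obtain ⟨c, -, hcl⟩ := exists_properOn G S
  have := hcl u hu
  omega

theorem chiOn_le_one {S : Set V} (h : ∀ u ∈ S, ∀ v ∈ S, ¬ G.Adj u v) : chiOn G S ≤ 1 :=
  chiOn_le_of_properOn (c := fun _ => 0) (T := {0}) (fun u hu v hv e => (h u hu v hv e).elim)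
    (by simp)

theorem chiOn_biUnion_le {ι : Type*} (I : Finset ι) (S : ι → Set V) :
    chiOn G (⋃ i ∈ I, S i) ≤ ∑ i ∈ I, chiOn G (S i) := by
  classical
  induction I using Finset.induction_on with
  | empty => simp [chiOn_empty]
  | insert i I hi ih =>
    rw [Finset.set_biUnion_insert, Finset.sum_insert hi]
    exact (chiOn_union_le _ _).trans (by gcongr)

/-- The chromatic number is superadditive over pairwise completely joined sets. -/
theorem sum_chiOn_le {ι : Type*} (I : Finset ι) (S : ι → Set V) {U : Set V}
    (hU : ∀ i ∈ I, S i ⊆ U)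
    (hadj : ∀ i ∈ I, ∀ j ∈ I, i ≠ j → ∀ x ∈ S i, ∀ y ∈ S j, G.Adj x y) :
    ∑ i ∈ I, chiOn G (S i) ≤ chiOn G U := by
  classical
  have := Fintype.ofFinite V
  obtain ⟨c, hc, hcl⟩ := exists_properOn G U
  have h1 : ∀ i ∈ I, chiOn G (S i) ≤ #((S i).toFinset.image c) := fun i hi =>
    chiOn_le_of_properOn (hc.mono (hU i hi)) fun v hv =>
      Finset.mem_image_of_mem _ (Set.mem_toFinset.2 hv)
  calc ∑ i ∈ I, chiOn G (S i) ≤ ∑ i ∈ I, #((S i).toFinset.image c) := Finset.sum_le_sum h1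
    _ = #(I.biUnion fun i => (S i).toFinset.image c) := by
      rw [Finset.card_biUnion]
      -- A colour common to two of the sets would appear at both ends of an edge.
      intro i hi j hj hij
      rw [Function.onFun, Finset.disjoint_left]
      intro a ha hb
      simp only [Finset.mem_image, Set.mem_toFinset] at ha hb
      obtain ⟨x, hx, rfl⟩ := ha
      obtain ⟨y, hy, hxy⟩ := hb
      exact hc x (hU i hi hx) y (hU j hj hy) (hadj i hi j hj hij x hx y hy) hxy.symm
    _ ≤ #(Finset.range (chiOn G U)) := by
      refine Finset.card_le_card fun a ha => ?_
      simp only [Finset.mem_biUnion, Finset.mem_image, Set.mem_toFinset] at ha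
      obtain ⟨i, hi, x, hx, rfl⟩ := ha
      simpa using hcl x (hU i hi hx)
    _ = _ := Finset.card_range _

theorem add_chiOn_le {S T U : Set V} (hS : S ⊆ U) (hT : T ⊆ U)
    (hadj : ∀ x ∈ S, ∀ y ∈ T, G.Adj x y) : chiOn G S + chiOn G T ≤ chiOn G U := by
  have := sum_chiOn_le (G := G) (Finset.univ : Finset Bool) (fun b => bif b then S else T) (U := U)
    (by simp [hS, hT]) (by
      intro i _ j _ hij x hx y hy
      cases i <;> cases j <;> simp at hij hx hy
      · exact (hadj y hy x hx).symm
      · exact hadj x hx y hy)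
  simpa [Fintype.sum_bool] using this

/-- A set partitioned by a fixed-point-free involution into independent pairs needs at most half as
many colours as it has elements. -/
theorem two_mul_chiOn_le_card (S : Finset V) (f : V → V) (hf : ∀ x ∈ S, f x ∈ S)
    (hne : ∀ x ∈ S, f x ≠ x) (hinv : ∀ x ∈ S, f (f x) = x) (hadj : ∀ x ∈ S, ¬ G.Adj x (f x)) :
    2 * chiOn G (S : Set V) ≤ #S := by
  classical
  have h1 : chiOn G (S : Set V) ≤ #(S.image fun x => s(x, f x)) :=
    chiOn_le_of_properOn (c := fun x => s(x, f x)) (fun u hu v hv h e => by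
      rcases Sym2.eq_iff.1 e with ⟨rfl, -⟩ | ⟨rfl, h2⟩
      · exact h.ne rfl
      · exact hadj v hv h.symm) fun v hv => Finset.mem_image_of_mem _ hv
  refine le_trans (Nat.mul_le_mul_left 2 h1) (Finset.mul_card_image_le_card _ _ fun a ha => ?_)
  obtain ⟨x, hx, rfl⟩ := Finset.mem_image.1 ha
  rw [← Finset.card_pair (hne x hx).symm]
  refine Finset.card_le_card fun y hy => ?_
  rcases Finset.mem_insert.1 hy with rfl | hy
  · simp [hx]
  · rw [Finset.mem_singleton.1 hy]
    simp [hf x hx, hinv x hx]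

end Basics

/-! ### Tutte's theorem in the complement: barriers. -/

section Barrier

/-- If a graph of even order has no perfect matching, then deleting some `A` leaves a vertex set
that splits into at least `#A + 2` parts of odd order without edges between them. -/
theorem exists_odd_parts {W : Type*} [Fintype W] [DecidableEq W] (C : SimpleGraph W)
    (heven : Even (Fintype.card W)) (hM : ∀ M : C.Subgraph, ¬ M.IsPerfectMatching) :
    ∃ (A : Finset W) (P : Finset (Finset W)), P.biUnion id = Aᶜ ∧ (∀ D ∈ P, Odd #D) ∧
      (∀ D ∈ P, ∀ E ∈ P, D ≠ E → ∀ x ∈ D, ∀ y ∈ E, x ≠ y ∧ ¬ C.Adj x y) ∧ #A + 2 ≤ #P := by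
  classical
  obtain ⟨u, hu⟩ : ∃ u, C.IsTutteViolator u := by
    by_contra! h
    obtain ⟨M, h⟩ := SimpleGraph.tutte.2 h
    exact hM M h
  unfold SimpleGraph.IsTutteViolator at hu
  set K := ((⊤ : C.Subgraph).deleteVerts u).coe with hK
  let Q := ↥((⊤ : C.Subgraph).deleteVerts u).verts
  have hmemQ : ∀ x : W, x ∈ ((⊤ : C.Subgraph).deleteVerts u).verts ↔ x ∉ u := by simp
  let O : Finset K.ConnectedComponent := K.oddComponents.toFinset
  have hO : #O = K.oddComponents.ncard := (Set.ncard_eq_toFinset_card' _).symm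
  have hcardQ : Fintype.card Q + u.ncard = Fintype.card W := by
    have : Fintype.card Q = #(u.toFinsetᶜ) := by
      rw [← Finset.card_univ, ← Finset.card_map (Function.Embedding.subtype _)]
      congr 1
      ext x
      simp
    rw [this, Set.ncard_eq_toFinset_card', Finset.card_compl_add_card]
  have hpar : Odd #O ↔ Odd (Fintype.card Q) := by
    rw [hO, SimpleGraph.odd_ncard_oddComponents, Nat.card_eq_fintype_card]
  obtain ⟨c₀, hc₀⟩ : O.Nonempty := Finset.card_pos.1 (by omega)
  -- All even components are merged into one odd component `c₀`, so that the parts cover everything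
  -- outside `u`.
  let l : Q → K.ConnectedComponent := fun p =>
    if K.connectedComponentMk p ∈ O then K.connectedComponentMk p else c₀
  have hl : ∀ p, l p ∈ O := fun p => by
    by_cases h : K.connectedComponentMk p ∈ O <;> simp [l, h, hc₀]
  let F : K.ConnectedComponent → Finset Q := fun c => univ.filter fun p => l p = c
  have hF : ∀ c ∈ O, c ≠ c₀ → Odd #(F c) := by
    intro c hc hne
    have : (F c : Set Q) = c.supp := by
      ext p
      simp only [F, l, Finset.coe_filter, Finset.mem_univ, true_and, Set.mem_ofPred_eq,
        SimpleGraph.ConnectedComponent.mem_supp_iff]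
      constructor
      · intro h
        split_ifs at h with h'
        · exact h
        · exact (hne h.symm).elim
      · rintro rfl
        simp [hc]
    have h2 := Set.mem_toFinset.1 hc
    change Odd c.supp.ncard at h2
    rwa [← this, Set.ncard_coe_finset] at h2
  -- The part of `c₀` is odd by parity: otherwise exactly `#O - 1` parts would be odd, while the
  -- total size has the parity of `#O`.
  have hF₀ : Odd #(F c₀) := by
    by_contra hne
    have hsum : ∑ c ∈ O, #(F c) = Fintype.card Q := by
      rw [← Finset.card_univ]
      exact (Finset.card_eq_sum_card_fiberwise fun p _ => hl p).symm
    have := Finset.odd_sum_iff_odd_card_odd (s := O) (fun c => #(F c))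
    rw [hsum, ← hpar] at this
    have h3 : (O.filter fun c => Odd #(F c)) = O.erase c₀ := by
      ext c
      simp only [Finset.mem_filter, Finset.mem_erase]
      constructor
      · rintro ⟨h1, h2⟩
        exact ⟨fun e => hne (e ▸ h2), h1⟩
      · rintro ⟨h1, h2⟩
        exact ⟨h2, hF c h2 h1⟩
    rw [h3, Finset.card_erase_of_mem hc₀] at this
    have hpos := Finset.card_pos.2 ⟨c₀, hc₀⟩
    rw [Nat.odd_iff, Nat.odd_iff] at this
    omega
  have hodd : ∀ c ∈ O, Odd #(F c) := fun c hc => by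
    by_cases h : c = c₀
    · exact h ▸ hF₀
    · exact hF c hc h
  let E : K.ConnectedComponent → Finset W := fun c => (F c).map (Function.Embedding.subtype _)
  have hE : ∀ c x, x ∈ E c ↔ ∃ h : x ∉ u, l ⟨x, (hmemQ x).2 h⟩ = c := by
    intro c x
    simp only [E, F, Finset.mem_map, Finset.mem_filter, Finset.mem_univ, true_and,
      Function.Embedding.subtype_apply]
    constructor
    · rintro ⟨p, h, rfl⟩
      exact ⟨(hmemQ _).1 p.2, h⟩
    · rintro ⟨h, h'⟩
      exact ⟨_, h', rfl⟩
  have hinj : Set.InjOn E O := by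
    intro c hc d hd h
    obtain ⟨p, hp⟩ := Finset.card_pos.1 (hodd c hc).pos
    have h1 : (p : W) ∈ E c := Finset.mem_map_of_mem _ hp
    have h2 := h ▸ h1
    obtain ⟨_, h1⟩ := (hE _ _).1 h1
    obtain ⟨_, h2⟩ := (hE _ _).1 h2
    exact h1.symm.trans h2
  refine ⟨u.toFinset, O.image E, ?_, ?_, ?_, ?_⟩
  · ext x
    simp only [Finset.mem_biUnion, Finset.mem_image, id, Finset.mem_compl, Set.mem_toFinset]
    constructor
    · rintro ⟨_, ⟨c, -, rfl⟩, hx⟩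
      exact ((hE _ _).1 hx).1
    · intro hx
      exact ⟨_, ⟨_, hl ⟨x, (hmemQ x).2 hx⟩, rfl⟩, (hE _ _).2 ⟨hx, rfl⟩⟩
  · simp only [Finset.mem_image]
    rintro _ ⟨c, hc, rfl⟩
    simpa [E] using hodd c hc
  · simp only [Finset.mem_image]
    rintro _ ⟨c, hc, rfl⟩ _ ⟨d, hd, rfl⟩ hcd x hx y hy
    obtain ⟨hxu, hx⟩ := (hE _ _).1 hx
    obtain ⟨hyu, hy⟩ := (hE _ _).1 hy
    have hne : c ≠ d := fun e => hcd (e ▸ rfl)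
    refine ⟨fun e => ?_, fun e => ?_⟩
    · subst e
      exact hne (hx.symm.trans hy)
    · have h1 : K.Adj ⟨x, (hmemQ x).2 hxu⟩ ⟨y, (hmemQ y).2 hyu⟩ := by
        simp [K, hxu, hyu, e]
      have h2 : K.connectedComponentMk ⟨x, (hmemQ x).2 hxu⟩ =
          K.connectedComponentMk ⟨y, (hmemQ y).2 hyu⟩ :=
        SimpleGraph.ConnectedComponent.sound h1.reachable
      refine hne (hx.symm.trans (Eq.trans ?_ hy))
      simp only [l, h2]
  · rw [Finset.card_image_of_injOn hinj]
    -- Even order makes `#O` and `u.ncard` congruent mod 2, so the strict Tutte inequality has a gap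
    -- of at least 2.
    have h1 : #u.toFinset = u.ncard := (Set.ncard_eq_toFinset_card' _).symm
    rw [Nat.odd_iff, Nat.odd_iff] at hpar
    rw [Nat.even_iff] at heven
    omega

variable {V : Type*} {G : SimpleGraph V}

/-- `A` together with a partition of `S \ A` into many odd parts, any two of which are completely
joined in `G`; such a pair certifies that the complement of `G[S]` has no perfect matching. -/
structure IsBarrier (G : SimpleGraph V) (S A : Finset V) (P : Finset (Finset V)) : Prop where
  subset : A ⊆ S
  mem_iff : ∀ x, (∃ D ∈ P, x ∈ D) ↔ x ∈ S ∧ x ∉ A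
  odd : ∀ D ∈ P, Odd #D
  adj : ∀ D ∈ P, ∀ E ∈ P, D ≠ E → ∀ x ∈ D, ∀ y ∈ E, G.Adj x y
  card : #A + 2 ≤ #P

theorem IsBarrier.disjoint {S A : Finset V} {P : Finset (Finset V)} (h : IsBarrier G S A P)
    {D E : Finset V} (hD : D ∈ P) (hE : E ∈ P) (hne : D ≠ E) : Disjoint D E :=
  Finset.disjoint_left.2 fun x hx hy => (h.adj D hD E hE hne x hx x hy).ne rfl

theorem IsBarrier.sum_card [DecidableEq V] {S A : Finset V} {P : Finset (Finset V)}
    (h : IsBarrier G S A P) : ∑ D ∈ P, #D + #A = #S := by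
  have h1 : P.biUnion id = S \ A := by
    ext x
    simpa using h.mem_iff x
  have h2 := Finset.card_biUnion (s := P) (t := id) fun D hD E hE hne => h.disjoint hD hE hne
  rw [h1] at h2
  rw [← Finset.card_sdiff_add_card_eq_card h.subset, h2]
  rfl

variable [Finite V]

/-- A perfect matching of the complement would colour `S` by pairs with `#S / 2` colours. Hence
there is none, and Tutte's theorem applies to the complement `C`. -/
theorem exists_isBarrier {S : Finset V} (heven : Even #S) (hS : #S < 2 * chiOn G (S : Set V)) :
    ∃ A P, IsBarrier G S A P := by
  classical
  let C : SimpleGraph S := SimpleGraph.fromRel fun x y => ¬ G.Adj x y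
  have hM : ∀ M : C.Subgraph, ¬ M.IsPerfectMatching := by
    intro M hM
    rw [SimpleGraph.Subgraph.isPerfectMatching_iff] at hM
    choose g hg hg' using hM
    have hgg : ∀ v, g (g v) = v := fun v => (hg' _ _ (hg v).symm).symm
    have hgadj : ∀ v, C.Adj v (g v) := fun v => (hg v).adj_sub
    let f : V → V := fun x => if h : x ∈ S then g ⟨x, h⟩ else x
    have hf : ∀ x (h : x ∈ S), f x = g ⟨x, h⟩ := fun x h => by simp [f, h]
    refine hS.not_ge (two_mul_chiOn_le_card S f ?_ ?_ ?_ ?_)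
    · intro x hx
      rw [hf x hx]
      exact (g _).2
    · intro x hx e
      rw [hf x hx] at e
      exact (hgadj ⟨x, hx⟩).ne (Subtype.ext e.symm)
    · intro x hx
      rw [hf x hx, hf _ (g _).2, Subtype.coe_eta, hgg]
    · intro x hx
      have := hgadj ⟨x, hx⟩
      simp only [C, SimpleGraph.fromRel_adj] at this
      rw [hf x hx]
      exact this.2.elim id fun h h' => h h'.symm
  obtain ⟨A, P, h1, h2, h3, h4⟩ := exists_odd_parts C (by simpa using heven) hM
  let e : S ↪ V := Function.Embedding.subtype _
  have h1' : ∀ x, (∃ D ∈ P, x ∈ D) ↔ x ∉ A := fun x => by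
    have := Finset.ext_iff.1 h1 x
    simpa using this
  refine ⟨A.map e, P.image fun D => D.map e, ⟨?_, ?_, ?_, ?_, ?_⟩⟩
  · intro x hx
    obtain ⟨y, -, rfl⟩ := Finset.mem_map.1 hx
    exact y.2
  · intro x
    constructor
    · rintro ⟨D, hD, hx⟩
      obtain ⟨D', hD', rfl⟩ := Finset.mem_image.1 hD
      obtain ⟨y, hy, rfl⟩ := Finset.mem_map.1 hx
      refine ⟨y.2, fun h => ?_⟩
      rw [Finset.mem_map' e] at h
      exact (h1' y).1 ⟨D', hD', hy⟩ h
    · rintro ⟨hx, hxA⟩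
      have : (⟨x, hx⟩ : S) ∉ A := fun h => hxA (Finset.mem_map.2 ⟨_, h, rfl⟩)
      obtain ⟨D, hD, h⟩ := (h1' _).2 this
      exact ⟨_, Finset.mem_image_of_mem _ hD, Finset.mem_map.2 ⟨_, h, rfl⟩⟩
  · intro D hD
    obtain ⟨D', hD', rfl⟩ := Finset.mem_image.1 hD
    simpa using h2 D' hD'
  · intro D hD E hE hne x hx y hy
    obtain ⟨D', hD', rfl⟩ := Finset.mem_image.1 hD
    obtain ⟨E', hE', rfl⟩ := Finset.mem_image.1 hE
    obtain ⟨x', hx', rfl⟩ := Finset.mem_map.1 hx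
    obtain ⟨y', hy', rfl⟩ := Finset.mem_map.1 hy
    obtain ⟨h5, h6⟩ := h3 D' hD' E' hE' (fun h => hne (h ▸ rfl)) x' hx' y' hy'
    by_contra h7
    exact h6 ((SimpleGraph.fromRel_adj _ _ _).2 ⟨h5, Or.inl h7⟩)
  · rwa [Finset.card_map, Finset.card_image_of_injective _ (Finset.map_injective e)]

/-- In a barrier `(A, P)` with `#A` as large as possible, every part is factor-critical in the
complement, so that deleting any vertex leaves a set that can be coloured by pairs. -/
theorem exists_isBarrier_factorCritical [DecidableEq V] {S : Finset V} (heven : Even #S)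
    (hS : #S < 2 * chiOn G (S : Set V)) :
    ∃ A P, IsBarrier G S A P ∧
      ∀ D ∈ P, ∀ b ∈ D, 2 * chiOn G ((D.erase b : Finset V) : Set V) + 1 ≤ #D := by
  classical
  have hex : ∃ n, ∃ A P, IsBarrier G S A P ∧ #A = n := by
    obtain ⟨A, P, h⟩ := exists_isBarrier heven hS
    exact ⟨_, A, P, h, rfl⟩
  have hbd : ∀ n, (∃ A P, IsBarrier G S A P ∧ #A = n) → n ≤ #S := by
    rintro _ ⟨A, P, h, rfl⟩
    exact Finset.card_le_card h.subset
  obtain ⟨n₀, hn₀⟩ := hex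
  obtain ⟨A, P, hAP, hA⟩ :=
    Nat.findGreatest_spec (P := fun n => ∃ A P, IsBarrier G S A P ∧ #A = n) (hbd _ hn₀) hn₀
  have hmax : ∀ A' P', IsBarrier G S A' P' → #A' ≤ #A := fun A' P' h => by
    rw [hA]
    exact Nat.le_findGreatest (hbd _ ⟨A', P', h, rfl⟩) ⟨A', P', h, rfl⟩
  refine ⟨A, P, hAP, fun D hD b hb => ?_⟩
  by_contra hlt
  have hcard := Finset.card_erase_add_one hb
  have hev : Even #(D.erase b) := by
    have := hAP.odd D hD
    rw [← hcard, Nat.odd_add_one, Nat.not_odd_iff_even] at this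
    exact this
  obtain ⟨B, Q, hB⟩ := exists_isBarrier (G := G) (S := D.erase b) hev (by omega)
  have hDS : ∀ x ∈ D, x ∈ S ∧ x ∉ A := fun x hx => (hAP.mem_iff x).1 ⟨D, hD, hx⟩
  have hBD : ∀ x ∈ B, x ∈ D := fun x hx => Finset.mem_of_mem_erase (hB.subset hx)
  have hQD : ∀ E ∈ Q, ∀ x ∈ E, x ∈ D ∧ x ≠ b ∧ x ∉ B := fun E hE x hx => by
    have := (hB.mem_iff x).1 ⟨E, hE, hx⟩
    simp only [Finset.mem_erase] at this
    tauto
  have hbB : b ∉ B := fun h => by simpa using hB.subset h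
  have hdisj : Disjoint A (insert b B) := by
    rw [Finset.disjoint_left]
    intro x hx hx'
    rcases Finset.mem_insert.1 hx' with rfl | h
    · exact (hDS _ hb).2 hx
    · exact (hDS _ (hBD x h)).2 hx
  have hPQ : Disjoint (P.erase D) Q := by
    rw [Finset.disjoint_left]
    intro E hE hE'
    obtain ⟨x, hx⟩ := Finset.card_pos.1 (hB.odd E hE').pos
    exact Finset.disjoint_left.1
      (hAP.disjoint (Finset.mem_of_mem_erase hE) hD (Finset.ne_of_mem_erase hE)) hx
      (hQD E hE' x hx).1
  -- Refining `D` by `b` and the barrier of `D.erase b` adds `#B + 1` to `#A` and at least as much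
  -- to `#P`, contradicting the maximality of `#A`.
  have hnew : IsBarrier G S (A ∪ insert b B) (P.erase D ∪ Q) := by
    refine ⟨?_, ?_, ?_, ?_, ?_⟩
    · refine Finset.union_subset hAP.subset fun x hx => ?_
      rcases Finset.mem_insert.1 hx with rfl | h
      · exact (hDS _ hb).1
      · exact (hDS _ (hBD x h)).1
    · intro x
      constructor
      · rintro ⟨E, hE, hx⟩
        rcases Finset.mem_union.1 hE with hE | hE
        · have h1 := (hAP.mem_iff x).1 ⟨E, Finset.mem_of_mem_erase hE, hx⟩
          have h2 : x ∉ D := Finset.disjoint_left.1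
            (hAP.disjoint (Finset.mem_of_mem_erase hE) hD (Finset.ne_of_mem_erase hE)) hx
          refine ⟨h1.1, fun h => ?_⟩
          simp only [Finset.mem_union, Finset.mem_insert] at h
          rcases h with h | rfl | h
          · exact h1.2 h
          · exact h2 hb
          · exact h2 (hBD x h)
        · obtain ⟨h1, h2, h3⟩ := hQD E hE x hx
          have := hDS x h1
          simp only [Finset.mem_union, Finset.mem_insert]
          tauto
      · rintro ⟨hx, hx'⟩
        simp only [Finset.mem_union, Finset.mem_insert, not_or] at hx'
        obtain ⟨E, hE, hxE⟩ := (hAP.mem_iff x).2 ⟨hx, hx'.1⟩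
        by_cases hED : E = D
        · subst hED
          obtain ⟨F, hF, hxF⟩ := (hB.mem_iff x).2 ⟨Finset.mem_erase.2 ⟨hx'.2.1, hxE⟩, hx'.2.2⟩
          exact ⟨F, Finset.mem_union_right _ hF, hxF⟩
        · exact ⟨E, Finset.mem_union_left _ (Finset.mem_erase.2 ⟨hED, hE⟩), hxE⟩
    · intro E hE
      rcases Finset.mem_union.1 hE with hE | hE
      · exact hAP.odd E (Finset.mem_of_mem_erase hE)
      · exact hB.odd E hE
    · intro E hE F hF hne x hx y hy
      rcases Finset.mem_union.1 hE with hE | hE <;> rcases Finset.mem_union.1 hF with hF | hF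
      · exact hAP.adj E (Finset.mem_of_mem_erase hE) F (Finset.mem_of_mem_erase hF) hne x hx y hy
      · exact hAP.adj E (Finset.mem_of_mem_erase hE) D hD (Finset.ne_of_mem_erase hE) x hx y
          (hQD F hF y hy).1
      · exact (hAP.adj F (Finset.mem_of_mem_erase hF) D hD (Finset.ne_of_mem_erase hF) y hy x
          (hQD E hE x hx).1).symm
      · exact hB.adj E hE F hF hne x hx y hy
    · rw [Finset.card_union_of_disjoint hPQ, Finset.card_union_of_disjoint hdisj,
        Finset.card_insert_of_notMem hbB, Finset.card_erase_of_mem hD]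
      have := hAP.card
      have := hB.card
      omega
  have := hmax _ _ hnew
  rw [Finset.card_union_of_disjoint hdisj, Finset.card_insert_of_notMem hbB] at this
  omega

end Barrier

/-! ### Gallai's theorem, by Hall's theorem applied to a barrier. -/

section Join

theorem exists_injOn_of_hall {ι α : Type*} [DecidableEq α] [Nonempty α] (I : Finset ι)
    (t : ι → Finset α) (h : ∀ J ⊆ I, #J ≤ #(J.biUnion t)) :
    ∃ f : ι → α, Set.InjOn f I ∧ ∀ i ∈ I, f i ∈ t i := by
  classical
  obtain ⟨f, hf, hft⟩ := (Finset.all_card_le_biUnion_card_iff_exists_injective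
    (fun i : I => t i)).1 fun J => by
      have := h (J.map (Function.Embedding.subtype _)) fun x hx => by
        obtain ⟨y, -, rfl⟩ := Finset.mem_map.1 hx
        exact y.2
      rw [Finset.card_map] at this
      refine this.trans (Finset.card_le_card fun x hx => ?_)
      simp only [Finset.mem_biUnion, Finset.mem_map] at hx ⊢
      obtain ⟨_, ⟨i, hi, rfl⟩, hx⟩ := hx
      exact ⟨i, hi, hx⟩
  refine ⟨fun i => if hi : i ∈ I then f ⟨i, hi⟩ else Classical.arbitrary α, ?_, ?_⟩
  · intro i hi j hj hij
    simp only [Finset.mem_coe] at hi hj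
    simp only [hi, hj, dif_pos] at hij
    exact congrArg Subtype.val (hf hij)
  · intro i hi
    simpa [hi] using hft ⟨i, hi⟩

variable {V : Type*} [Finite V] {G : SimpleGraph V}

/-- If every part either can be coloured by fewer than half its order or is matched by a non-edge
to its own vertex of `B`, then one colour for each vertex of `B` suffices on top of pairs. -/
theorem two_mul_chiOn_add_card_le [DecidableEq V] {P I : Finset (Finset V)} {B : Finset V}
    (hP : ∀ D ∈ P, ∀ b ∈ D, 2 * chiOn G ((D.erase b : Finset V) : Set V) + 1 ≤ #D)
    (f : Finset V → V) (hf : Set.InjOn f I)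
    (hfI : ∀ D ∈ I, ∃ b ∈ D, ¬ G.Adj (f D) b) (hfB : ∀ D ∈ I, f D ∈ B)
    (hI : ∀ D ∈ P, D ∉ I → 2 * chiOn G (D : Set V) + 1 ≤ #D) :
    2 * chiOn G ((B : Set V) ∪ ⋃ D ∈ P, (D : Set V)) + #P ≤ 2 * #B + ∑ D ∈ P, #D := by
  have hβ : ∀ D, ∃ b, D ∈ I → b ∈ D ∧ ¬ G.Adj (f D) b := fun D => by
    by_cases hD : D ∈ I
    · obtain ⟨b, hb⟩ := hfI D hD
      exact ⟨b, fun _ => hb⟩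
    · exact ⟨f D, fun h => (hD h).elim⟩
  choose β hβ using hβ
  -- A matched part gives up `β D`, which joins the colour class `M a` of its partner `a`.
  -- Injectivity of `f` on `I` puts at most one such vertex in `M a`, so `M a` is independent.
  let R : Finset V → Set V := fun D => if D ∈ I then ((D.erase (β D) : Finset V) : Set V) else D
  let M : V → Set V := fun a => {x | x = a ∨ ∃ D ∈ I, f D = a ∧ x = β D}
  have hR : ∀ D ∈ P, 2 * chiOn G (R D) + 1 ≤ #D := fun D hD => by
    by_cases h : D ∈ I
    · simpa only [R, if_pos h] using hP D hD _ (hβ D h).1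
    · simpa only [R, if_neg h] using hI D hD h
  have hM : ∀ a, chiOn G (M a) ≤ 1 := fun a => by
    refine chiOn_le_one ?_
    rintro u (rfl | ⟨D, hD, hDa, rfl⟩) v (rfl | ⟨E, hE, hEa, rfl⟩)
    · exact G.irrefl
    · rw [← hEa]
      exact (hβ E hE).2
    · rw [← hDa, G.adj_comm]
      exact (hβ D hD).2
    · rw [hf hD hE (hDa.trans hEa.symm)]
      exact G.irrefl
  have hcover : ((B : Set V) ∪ ⋃ D ∈ P, (D : Set V)) ⊆ (⋃ D ∈ P, R D) ∪ ⋃ a ∈ B, M a := by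
    rintro x (hx | hx)
    · exact Or.inr (Set.mem_biUnion hx (Or.inl rfl))
    · simp only [Set.mem_iUnion] at hx
      obtain ⟨D, hD, hx⟩ := hx
      by_cases h : D ∈ I
      · by_cases hxb : x = β D
        · exact Or.inr (Set.mem_biUnion (hfB D h) (Or.inr ⟨D, h, rfl, hxb⟩))
        · refine Or.inl (Set.mem_biUnion hD ?_)
          simp only [R, if_pos h, Finset.coe_erase]
          exact ⟨hx, hxb⟩
      · refine Or.inl (Set.mem_biUnion hD ?_)
        simpa only [R, if_neg h] using hx
  have h1 := (chiOn_mono (G := G) hcover).trans (chiOn_union_le _ _)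
  have h2 := chiOn_biUnion_le (G := G) P R
  have h3 := (chiOn_biUnion_le (G := G) B M).trans (Finset.sum_le_sum fun a _ => hM a)
  have h4 := Finset.sum_le_sum hR
  rw [Finset.sum_add_distrib, ← Finset.mul_sum] at h4
  simp only [Finset.sum_const, smul_eq_mul, mul_one] at h3 h4
  omega

/-- Take a barrier `(A, P)` with factor-critical parts, and try to match every expensive part `D`
(those in `T`) to its own vertex of `A` having a non-neighbour in `D`. Success would colour `S` too
cheaply. A minimal failure of Hall's condition is a family `Q` whose union is completely joined to
all of `S` outside it and the few vertices of `A` in `Q.biUnion t`. -/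
theorem exists_join_of_card_add_two_eq {S : Finset V} (hS : #S + 2 = 2 * chiOn G (S : Set V)) :
    ∃ X Y : Finset V, X ⊆ S ∧ Y ⊆ S ∧ X.Nonempty ∧ Y.Nonempty ∧
      (∀ x ∈ X, ∀ y ∈ Y, G.Adj x y) ∧
      chiOn G (S : Set V) ≤ chiOn G (X : Set V) + chiOn G (Y : Set V) := by
  classical
  obtain ⟨A, P, hAP, hcrit⟩ := exists_isBarrier_factorCritical (G := G) (S := S)
    (by rw [Nat.even_iff]; omega) (by omega)
  have hsum := hAP.sum_card
  have hcardP := hAP.card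
  have hne : ∀ D ∈ P, D.Nonempty := fun D hD => Finset.card_pos.1 (hAP.odd D hD).pos
  have : Nonempty V := by
    obtain ⟨D, hD⟩ := Finset.card_pos.1 (show 0 < #P by omega)
    exact ⟨(hne D hD).choose⟩
  let T := P.filter fun D => #D + 1 ≤ 2 * chiOn G (D : Set V)
  have hTP : T ⊆ P := Finset.filter_subset _ _
  have hT : ∀ D ∈ P, D ∉ T → 2 * chiOn G (D : Set V) + 1 ≤ #D := fun D hD h => by
    have h1 : ¬ #D + 1 ≤ 2 * chiOn G (D : Set V) := fun h' => h (Finset.mem_filter.2 ⟨hD, h'⟩)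
    have h2 := Nat.odd_iff.1 (hAP.odd D hD)
    omega
  let t : Finset V → Finset V := fun D => A.filter fun a => ∃ b ∈ D, ¬ G.Adj a b
  have htA : ∀ D a, a ∈ t D → a ∈ A ∧ ∃ b ∈ D, ¬ G.Adj a b := fun D a h => Finset.mem_filter.1 h
  by_cases hall : ∀ J ⊆ T, #J ≤ #(J.biUnion t)
  -- The matching yields `2χ(S) ≤ #S + #A - #P ≤ #S - 2`.
  · exfalso
    obtain ⟨f, hf, hft⟩ := exists_injOn_of_hall T t hall
    have h1 := two_mul_chiOn_add_card_le (B := A) hcrit f hf (fun D hD => (htA _ _ (hft D hD)).2)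
      (fun D hD => (htA _ _ (hft D hD)).1) hT
    have h2 : (S : Set V) ⊆ (A : Set V) ∪ ⋃ D ∈ P, (D : Set V) := fun x hx => by
      by_cases hxA : x ∈ A
      · exact Or.inl hxA
      · obtain ⟨D, hD, hxD⟩ := (hAP.mem_iff x).2 ⟨hx, hxA⟩
        exact Or.inr (Set.mem_biUnion hD hxD)
    have h3 := chiOn_mono (G := G) h2
    omega
  · push Not at hall
    obtain ⟨J, hJT, hJ⟩ := hall
    -- By minimality, Hall's condition holds once any single part `D₀` is removed from the violating
    -- family.
    obtain ⟨Q, hQ, hQmin⟩ := Finset.exists_min_image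
      (T.powerset.filter fun J => #(J.biUnion t) < #J) Finset.card
      ⟨J, Finset.mem_filter.2 ⟨Finset.mem_powerset.2 hJT, hJ⟩⟩
    obtain ⟨hQT, hQ⟩ := Finset.mem_filter.1 hQ
    rw [Finset.mem_powerset] at hQT
    have hQP := hQT.trans hTP
    obtain ⟨D₀, hD₀⟩ : Q.Nonempty := Finset.card_pos.1 (by omega)
    have hhall : ∀ J ⊆ Q.erase D₀, #J ≤ #(J.biUnion t) := fun J hJ => by
      by_contra hlt
      have h1 := hQmin J (Finset.mem_filter.2 ⟨Finset.mem_powerset.2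
        ((hJ.trans (Finset.erase_subset _ _)).trans hQT), by omega⟩)
      have h2 := Finset.card_le_card hJ
      have h3 := Finset.card_erase_add_one hD₀
      omega
    obtain ⟨f, hf, hft⟩ := exists_injOn_of_hall (Q.erase D₀) t hhall
    have hA₂ : Q.biUnion t ⊆ A := fun a ha => by
      obtain ⟨D, -, h⟩ := Finset.mem_biUnion.1 ha
      exact (htA _ _ h).1
    have hXS : Q.biUnion id ⊆ S := fun x hx => by
      obtain ⟨D, hD, h⟩ := Finset.mem_biUnion.1 hx
      exact ((hAP.mem_iff x).1 ⟨D, hQP hD, h⟩).1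
    refine ⟨Q.biUnion id, (S \ Q.biUnion id) \ Q.biUnion t, hXS,
      Finset.sdiff_subset.trans Finset.sdiff_subset, ?_, ?_, ?_, ?_⟩
    · obtain ⟨x, hx⟩ := hne D₀ (hQP hD₀)
      exact ⟨x, Finset.mem_biUnion.2 ⟨D₀, hD₀, hx⟩⟩
    -- Matching `Q.erase D₀` into `A` gives `#Q - 1 ≤ #A ≤ #P - 2`, so some part lies outside `Q`
    -- and hence in `Y`.
    · have h1 : #Q < #P := by
        have := Finset.card_le_card hA₂
        by_contra hlt
        have hQP' : Q = P := Finset.eq_of_subset_of_card_le hQP (by omega)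
        have h3 := Finset.card_le_card_of_injOn f
          (fun D hD => Finset.mem_biUnion.2 ⟨D, Finset.mem_of_mem_erase hD, hft D hD⟩) hf
        have h4 := Finset.card_erase_add_one hD₀
        omega
      obtain ⟨E, hE, hEQ⟩ := Finset.exists_mem_notMem_of_card_lt_card h1
      obtain ⟨x, hx⟩ := hne E hE
      have hxS := (hAP.mem_iff x).1 ⟨E, hE, hx⟩
      refine ⟨x, ?_⟩
      simp only [Finset.mem_sdiff]
      refine ⟨⟨hxS.1, fun h => ?_⟩, fun h => hxS.2 (hA₂ h)⟩
      obtain ⟨D, hD, hxD⟩ := Finset.mem_biUnion.1 h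
      exact Finset.disjoint_left.1 (hAP.disjoint hE (hQP hD) fun e => hEQ (e ▸ hD)) hx hxD
    · intro x hx y hy
      obtain ⟨D, hD, hxD⟩ := Finset.mem_biUnion.1 hx
      simp only [Finset.mem_sdiff] at hy
      obtain ⟨⟨hyS, hyX⟩, hyt⟩ := hy
      by_cases hyA : y ∈ A
      · by_contra hxy
        exact hyt (Finset.mem_biUnion.2 ⟨D, hD, Finset.mem_filter.2
          ⟨hyA, x, hxD, fun h => hxy h.symm⟩⟩)
      · obtain ⟨E, hE, hyE⟩ := (hAP.mem_iff y).2 ⟨hyS, hyA⟩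
        refine hAP.adj D (hQP hD) E hE ?_ x hxD y hyE
        rintro rfl
        exact hyX (Finset.mem_biUnion.2 ⟨D, hD, hyE⟩)
    · set X := Q.biUnion id
      set Y := (S \ X) \ Q.biUnion t
      -- Here `S` is covered by `Y`, `Z` and `D₀`. The costs are `χ(Z) ≤ #(Q.biUnion t) + ∑ (#D -
      -- 1)/2` over `Q.erase D₀`, and `χ(D₀) ≤ (#D₀ + 1)/2`. Since `#(Q.biUnion t) ≤ #Q - 1`, they
      -- total at most `∑ (#D + 1)/2` over `Q`, which is at most `χ(X)` because the parts are joined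
      -- and each lies in `T`.
      have h1 := two_mul_chiOn_add_card_le (B := Q.biUnion t) (P := Q.erase D₀) (I := Q.erase D₀)
        (fun D hD => hcrit D (hQP (Finset.mem_of_mem_erase hD))) f hf
        (fun D hD => (htA _ _ (hft D hD)).2)
        (fun D hD => Finset.mem_biUnion.2 ⟨D, Finset.mem_of_mem_erase hD, hft D hD⟩)
        fun D hD hD' => (hD' hD).elim
      set Z := ((Q.biUnion t : Finset V) : Set V) ∪ ⋃ D ∈ Q.erase D₀, (D : Set V)
      have h2 : (S : Set V) ⊆ (Y : Set V) ∪ (Z ∪ D₀) := fun x hx => by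
        by_cases hxt : x ∈ Q.biUnion t
        · exact Or.inr (Or.inl (Or.inl hxt))
        by_cases hxX : x ∈ X
        · obtain ⟨D, hD, hxD⟩ := Finset.mem_biUnion.1 hxX
          by_cases hDD : D = D₀
          · exact Or.inr (Or.inr (hDD ▸ hxD))
          · exact Or.inr (Or.inl (Or.inr (Set.mem_biUnion (Finset.mem_erase.2 ⟨hDD, hD⟩) hxD)))
        · exact Or.inl (Finset.mem_sdiff.2 ⟨Finset.mem_sdiff.2 ⟨hx, hxX⟩, hxt⟩)
      have h3 := (chiOn_mono (G := G) h2).trans (chiOn_union_le _ _)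
      have h4 := chiOn_union_le (G := G) Z D₀
      have h5 : 2 * chiOn G (D₀ : Set V) ≤ #D₀ + 1 := by
        obtain ⟨b, hb⟩ := hne D₀ (hQP hD₀)
        have h6 := hcrit D₀ (hQP hD₀) b hb
        have h7 : (D₀ : Set V) ⊆ ((D₀.erase b : Finset V) : Set V) ∪ {b} := fun x hx => by
          by_cases h : x = b <;> simp_all
        have h8 := (chiOn_mono (G := G) h7).trans (chiOn_union_le _ _)
        have h9 : chiOn G {b} ≤ 1 := chiOn_le_one (by simp)
        omega
      have h6 := sum_chiOn_le (G := G) Q (fun D => (D : Set V)) (U := (X : Set V))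
        (fun D hD x hx => Finset.mem_biUnion.2 ⟨D, hD, hx⟩)
        fun D hD E hE hne x hx y hy => hAP.adj D (hQP hD) E (hQP hE) hne x hx y hy
      have h7 : ∑ D ∈ Q, (#D + 1) ≤ ∑ D ∈ Q, 2 * chiOn G (D : Set V) :=
        Finset.sum_le_sum fun D hD => (Finset.mem_filter.1 (hQT hD)).2
      rw [← Finset.mul_sum, Finset.sum_add_distrib, ← Finset.card_eq_sum_ones,
        ← Finset.add_sum_erase _ _ hD₀] at h7
      have h8 := Finset.card_erase_add_one hD₀
      omega

/-- **Gallai's theorem**, in a form that needs no criticality: a graph on at most `2 * k - 2`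
vertices with chromatic number `k` contains two nonempty completely joined sets whose chromatic
numbers add up to at least `k`. -/
theorem exists_join_of_card_add_two_le {S : Finset V} (hS : #S + 2 ≤ 2 * chiOn G (S : Set V)) :
    ∃ X Y : Finset V, X ⊆ S ∧ Y ⊆ S ∧ X.Nonempty ∧ Y.Nonempty ∧
      (∀ x ∈ X, ∀ y ∈ Y, G.Adj x y) ∧
      chiOn G (S : Set V) ≤ chiOn G (X : Set V) + chiOn G (Y : Set V) := by
  classical
  -- Padding with `p` isolated vertices reaches equality without changing the chromatic number. No
  -- isolated vertex can lie in a join with both sides nonempty.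
  set p := 2 * chiOn G (S : Set V) - 2 - #S with hp
  let H : SimpleGraph (V ⊕ Fin p) := G ⊕g ⊥
  have hle : ∀ U : Finset (V ⊕ Fin p),
      chiOn H (U : Set (V ⊕ Fin p)) ≤ max 1 (chiOn G (U.toLeft : Set V)) := fun U => by
    obtain ⟨c, hc, hcl⟩ := exists_properOn G (U.toLeft : Set V)
    have := chiOn_le_of_properOn (G := H) (S := (U : Set (V ⊕ Fin p)))
      (c := Sum.elim c fun _ => 0) (T := Finset.range (max 1 (chiOn G (U.toLeft : Set V)))) ?_ ?_
    · simpa using this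
    · rintro (u | u) hu (v | v) hv h
      · exact hc u (by simpa using hu) v (by simpa using hv) (by simpa [H] using h)
      all_goals simp [H] at h
    · rintro (u | u) hu
      · have := hcl u (by simpa using hu)
        simp only [Sum.elim_inl, Finset.mem_range]
        omega
      · simp
  have hge : ∀ U : Finset (V ⊕ Fin p),
      chiOn G (U.toLeft : Set V) ≤ chiOn H (U : Set (V ⊕ Fin p)) := fun U => by
    obtain ⟨c, hc, hcl⟩ := exists_properOn H (U : Set (V ⊕ Fin p))
    have := chiOn_le_of_properOn (G := G) (S := (U.toLeft : Set V))
      (c := fun v => c (Sum.inl v)) (T := Finset.range (chiOn H (U : Set (V ⊕ Fin p))))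
      (fun u hu v hv h => hc _ (by simpa using hu) _ (by simpa using hv) (by simpa [H] using h))
      fun v hv => by simpa using hcl (Sum.inl v) (by simpa using hv)
    simpa using this
  let S' : Finset (V ⊕ Fin p) := S.disjSum Finset.univ
  have hchi : chiOn H (S' : Set (V ⊕ Fin p)) = chiOn G (S : Set V) := by
    have h1 := hle S'
    have h2 := hge S'
    simp only [S', Finset.toLeft_disjSum] at h1 h2
    exact le_antisymm (h1.trans (by omega)) h2
  obtain ⟨X, Y, hX, hY, ⟨x, hx⟩, ⟨y, hy⟩, hXY, hsum⟩ :=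
    exists_join_of_card_add_two_eq (G := H) (S := S') (by
      rw [hchi, Finset.card_disjSum, Finset.card_univ, Fintype.card_fin]
      omega)
  have hleft : ∀ u v : V ⊕ Fin p, H.Adj u v → ∃ w, u = Sum.inl w := by
    rintro (u | u) (v | v) h
    · exact ⟨u, rfl⟩
    all_goals simp [H] at h
  obtain ⟨x, rfl⟩ := hleft _ _ (hXY x hx y hy)
  obtain ⟨y, rfl⟩ := hleft _ _ (hXY _ hx y hy).symm
  have hx' : X.toLeft.Nonempty := ⟨x, by simpa using hx⟩
  have hy' : Y.toLeft.Nonempty := ⟨y, by simpa using hy⟩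
  refine ⟨X.toLeft, Y.toLeft, fun u hu => ?_, fun u hu => ?_, hx', hy', fun u hu v hv => ?_, ?_⟩
  · simpa [S'] using hX (Finset.mem_toLeft.1 hu)
  · simpa [S'] using hY (Finset.mem_toLeft.1 hu)
  · simpa [H] using hXY _ (Finset.mem_toLeft.1 hu) _ (Finset.mem_toLeft.1 hv)
  · have h1 := hle X
    have h2 := hle Y
    have h3 := one_le_chiOn (G := G) (Finset.coe_nonempty.2 hx')
    have h4 := one_le_chiOn (G := G) (Finset.coe_nonempty.2 hy')
    rw [max_eq_right h3] at h1
    rw [max_eq_right h4] at h2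
    omega

end Join

/-! ### Dense neighbourhoods and colourful vertices. -/

section Main

variable {V : Type*} [Finite V] {G : SimpleGraph V}

/-- In a graph with fewer than `5 / 3` times as many vertices as its chromatic number `k`, some
neighbourhood has chromatic number at least `k - 1`. -/
theorem exists_chiOn_le_chiOn_neighborSet_add_one (T : Finset V)
    (hT : 3 * T.card < 5 * chiOn G (T : Set V)) :
    ∃ v ∈ T, chiOn G (T : Set V) ≤ chiOn G ((T : Set V) ∩ G.neighborSet v) + 1 := by
  induction hn : T.card using Nat.strong_induction_on generalizing T with
  | _ n ih =>
  subst hn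
  -- The hypothesis forces `#T ≤ 2χ(T) - 2` only from `χ(T) = 3` on.
  rcases Nat.lt_or_ge (chiOn G (T : Set V)) 3 with hlt | hge
  · by_cases hE : ∃ u ∈ T, ∃ v ∈ T, G.Adj u v
    · obtain ⟨u, hu, v, hv, huv⟩ := hE
      have : 1 ≤ chiOn G ((T : Set V) ∩ G.neighborSet u) := one_le_chiOn ⟨v, hv, huv⟩
      exact ⟨u, hu, by omega⟩
    · have h1 : chiOn G (T : Set V) ≤ 1 :=
        chiOn_le_one fun u hu v hv h => hE ⟨u, hu, v, hv, h⟩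
      obtain ⟨v, hv⟩ : T.Nonempty := by
        rw [Finset.nonempty_iff_ne_empty]
        rintro rfl
        simp [chiOn_empty] at hT
      exact ⟨v, hv, by omega⟩
  · obtain ⟨X, Y, hX, hY, hXne, hYne, hXY, hsum⟩ :=
      exists_join_of_card_add_two_le (G := G) (S := T) (by omega)
    have key : ∀ X Y : Finset V, X ⊆ T → Y ⊆ T → Y.Nonempty →
        (∀ x ∈ X, ∀ y ∈ Y, G.Adj x y) →
        chiOn G (T : Set V) ≤ chiOn G (X : Set V) + chiOn G (Y : Set V) →
        3 * X.card < 5 * chiOn G (X : Set V) →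
        ∃ v ∈ T, chiOn G (T : Set V) ≤ chiOn G ((T : Set V) ∩ G.neighborSet v) + 1 := by
      intro X Y hX hY ⟨y, hy⟩ hXY hsum hlt
      have hcard : X.card < T.card := Finset.card_lt_card
        ⟨hX, fun h => (hXY y (h (hY hy)) y hy).ne rfl⟩
      obtain ⟨v, hv, hle⟩ := ih _ hcard X hlt rfl
      refine ⟨v, hX hv, ?_⟩
      have := add_chiOn_le (G := G) (S := (X : Set V) ∩ G.neighborSet v) (T := (Y : Set V))
        (U := (T : Set V) ∩ G.neighborSet v) (fun x hx => ⟨hX hx.1, hx.2⟩)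
        (fun y hy => ⟨hY hy, hXY v hv y hy⟩) fun x hx y hy => hXY x hx.1 y hy
      omega
    have hcard : X.card + Y.card ≤ T.card := by
      classical
      rw [← Finset.card_union_of_disjoint (Finset.disjoint_left.2 fun x hx hy =>
        (hXY x hx x hy).ne rfl)]
      exact Finset.card_le_card (Finset.union_subset hX hY)
    -- The ratio `5/3` is inherited by at least one side. A good vertex there also sees the whole
    -- other side, which contributes its full chromatic number.
    rcases Nat.lt_or_ge (3 * X.card) (5 * chiOn G (X : Set V)) with h | h
    · exact key X Y hX hY hYne hXY hsum h
    · exact key Y X hY hX hXne (fun y hy x hx => (hXY x hx y hy).symm) (by omega) (by omega)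

/-- If a colouring uses exactly `chi G` colours, every colour `a` is used on a vertex that sees all
other colours. -/
theorem exists_colourful {α : Type*} (σ : G.Coloring α) {R : Finset α} (hR : ∀ v, σ v ∈ R)
    (hcard : R.card ≤ chi G) {a : α} (ha : a ∈ R) :
    ∃ w, σ w = a ∧ ∀ b ∈ R, b ≠ a → ∃ x, G.Adj w x ∧ σ x = b := by
  classical
  -- Otherwise every vertex coloured `a` can move to a colour absent from its neighbourhood. The
  -- class is independent, so all move at once and a colour is saved.
  by_contra! hcon
  have : ∀ w, ∃ b, σ w = a → b ∈ R ∧ b ≠ a ∧ ∀ x, G.Adj w x → σ x ≠ b := fun w => by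
    by_cases h : σ w = a
    · obtain ⟨b, hb⟩ := hcon w h
      exact ⟨b, fun _ => hb⟩
    · exact ⟨a, fun h' => (h h').elim⟩
  choose g hg using this
  have h1 := chiOn_le_of_properOn (G := G) (S := Set.univ)
    (c := fun w => if σ w = a then g w else σ w) (T := R.erase a) ?_ ?_
  · rw [chiOn_univ] at h1
    have := Finset.card_erase_add_one ha
    omega
  · intro u _ v _ huv e
    by_cases hu : σ u = a <;> by_cases hv : σ v = a <;>
      simp only [hu, hv, if_true, if_false] at e
    · exact σ.valid huv (hu.trans hv.symm)
    · exact (hg u hu).2.2 v huv e.symm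
    · exact (hg v hv).2.2 u huv.symm e
    · exact σ.valid huv e
  · intro v _
    by_cases hv : σ v = a
    · simpa [hv] using ⟨(hg v hv).2.1, (hg v hv).1⟩
    · simpa [hv] using hR v

/-- If a colouring with exactly `chi G` colours has discrepancy at most `chi G - s` and `G` is
co-locally `(s - 1)`-colourable, then `G` is complete and the colouring is injective. -/
theorem injective_and_eq_top_of_card_eq {α : Type*} {s : ℕ} (σ : G.Coloring α)
    {R : Finset α} (hR : ∀ v, σ v ∈ R) (hcard : R.card = chi G)
    (hT : ∀ r : α → V, (∀ a ∈ R, σ (r a) = a) → s ≤ chiOn G (r '' R))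
    (hco : ∀ v u, u ≠ v → chiOn G ({u} ∪ G.neighborSet v) + 1 ≤ s) :
    Function.Injective σ ∧ G = ⊤ := by
  classical
  have huniq : ∀ a ∈ R, ∃ w, (∀ b ∈ R, b ≠ a → ∃ x, G.Adj w x ∧ σ x = b) ∧
      ∀ u, σ u = a → u = w := by
    intro a ha
    obtain ⟨w, hwa, hw⟩ := exists_colourful σ hR hcard.le ha
    refine ⟨w, hw, fun u hu => ?_⟩
    by_contra hne
    have : ∀ b, ∃ x, b ∈ R → b ≠ a → G.Adj w x ∧ σ x = b := fun b => by
      by_cases hb : b ∈ R ∧ b ≠ a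
      · obtain ⟨x, hx⟩ := hw b hb.1 hb.2
        exact ⟨x, fun _ _ => hx⟩
      · exact ⟨w, fun h1 h2 => (hb ⟨h1, h2⟩).elim⟩
    choose g hg using this
    have h1 := hT (fun b => if b = a then u else g b) fun b hb => by
      by_cases h : b = a
      · simpa [h] using hu
      · simpa [h] using (hg b hb h).2
    have h2 : (fun b => if b = a then u else g b) '' (R : Set α) ⊆ {u} ∪ G.neighborSet w := by
      rintro _ ⟨b, hb, rfl⟩
      by_cases h : b = a
      · exact Or.inl (by simp [h])
      · exact Or.inr (by simpa [h] using (hg b hb h).1)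
    have h3 := chiOn_mono (G := G) h2
    have h4 := hco w u hne
    omega
  have hinj : Function.Injective σ := fun u v huv => by
    obtain ⟨w, -, h⟩ := huniq (σ u) (hR u)
    rw [h u rfl, h v huv.symm]
  refine ⟨hinj, ?_⟩
  ext u v
  refine ⟨fun h => h.ne, fun hne => ?_⟩
  obtain ⟨w, hw, h⟩ := huniq (σ u) (hR u)
  obtain ⟨x, hx, hxv⟩ := hw (σ v) (hR v) fun e => hne (hinj e.symm)
  rwa [← h u rfl, hinj hxv] at hx

end Main

end ChromaticDiscrepancy

open ChromaticDiscrepancy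

theorem theorem4p7 {V : Type*} [Finite V] (G : SimpleGraph V) (s : ℕ) (hs : 3 ≤ s)
    (hco : ChromaticDiscrepancy.CoLocallyColourable G (s - 1))
    (hK : ¬ Nonempty (G ≃g (⊤ : SimpleGraph (Fin s))))
    (hchi : (ChromaticDiscrepancy.chi G : ℝ) < (5 * (s : ℝ) + 2) / 3) :
    (ChromaticDiscrepancy.chi G : ℤ) - (s : ℤ) + 1 ≤
      ChromaticDiscrepancy.chromaticDiscrepancy G := by
  classical
  have := Fintype.ofFinite V
  have hk : 3 * chi G < 5 * s + 2 := by
    have : (3 : ℝ) * chi G < 5 * s + 2 := by linarith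
    exact_mod_cast this
  have hco' : ∀ v u, u ≠ v → chiOn G ({u} ∪ G.neighborSet v) + 1 ≤ s := fun v u h => by
    have h1 := hco v u h
    rw [← coe_chi, Nat.cast_le] at h1
    change chiOn G _ ≤ _ at h1
    omega
  obtain ⟨σ, hσ⟩ := (isLeast_chromaticDiscrepancy G).1
  rw [← hσ]
  by_contra! hlt
  have hex : ∀ X : Set V, (σ '' X).ncard + s ≤ chiOn G X + chi G := fun X => by
    have h1 : excess G σ X ≤ colouringDiscrepancy G σ :=
      (isGreatest_colouringDiscrepancy G σ).2 ⟨X, rfl⟩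
    have h2 : excess G σ X = ((σ '' X).ncard : ℤ) - chiOn G X := rfl
    have h3 : colouringDiscrepancy G σ < (chi G : ℤ) - s + 1 := hlt
    omega
  let R := Finset.univ.image σ
  have hR : ∀ v, σ v ∈ R := fun v => Finset.mem_image_of_mem _ (Finset.mem_univ v)
  have hkR : chi G ≤ R.card := by
    rw [← chiOn_univ]
    exact chiOn_le_of_properOn (fun u _ v _ h => σ.valid h) fun v _ => hR v
  -- The empty subgraph already shows that the discrepancy is nonnegative.
  have hsk : s ≤ chi G := by simpa [chiOn_empty] using hex ∅
  have htrans : ∀ r : ℕ → V, (∀ a ∈ R, σ (r a) = a) →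
      R.card + s ≤ chiOn G (r '' R) + chi G := fun r hr => by
    have h1 : σ '' (r '' R) = R := by
      rw [Set.image_image]
      exact (Set.image_congr hr).trans (Set.image_id' _)
    have h2 := hex (r '' R)
    rwa [h1, Set.ncard_coe_finset] at h2
  rcases hkR.eq_or_lt with heq | hlt'
  · obtain ⟨hinj, rfl⟩ := injective_and_eq_top_of_card_eq σ hR heq.symm
      (fun r hr => by have := htrans r hr; omega) hco'
    have hcard : Fintype.card V = chi (⊤ : SimpleGraph V) := by
      rw [heq, Finset.card_image_of_injective _ hinj, Finset.card_univ]
    obtain ⟨u, v, huv⟩ := Fintype.exists_pair_of_one_lt_card (α := V) (by omega)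
    -- Only `v` is missing from `{u} ∪ N(v)`, so `χ(G) ≤ (s - 1) + 1`; with `hsk` the order is
    -- exactly `s`.
    have h1 : (Set.univ : Set V) ⊆ ({u} ∪ (⊤ : SimpleGraph V).neighborSet v) ∪ {v} := fun x _ => by
      by_cases h : x = v
      · exact Or.inr h
      · exact Or.inl (Or.inr (Ne.symm h))
    have h2 := (chiOn_mono (G := (⊤ : SimpleGraph V)) h1).trans (chiOn_union_le _ _)
    have h3 : chiOn (⊤ : SimpleGraph V) {v} ≤ 1 := chiOn_le_one (by simp)
    have h4 := hco' v u huv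
    rw [chiOn_univ] at h2
    exact hK ⟨SimpleGraph.Iso.completeGraph (Fintype.equivFinOfCardEq (by omega))⟩
  · have : Nonempty V := by
      obtain ⟨a, ha⟩ := Finset.card_pos.1 (by omega : 0 < R.card)
      obtain ⟨v, -, -⟩ := Finset.mem_image.1 ha
      exact ⟨v⟩
    have hr : ∀ a ∈ R, σ (Function.invFun σ a) = a := fun a ha => by
      obtain ⟨v, -, h⟩ := Finset.mem_image.1 ha
      exact Function.invFun_eq ⟨v, h⟩
    have h1 := htrans _ hr
    rw [← Finset.coe_image] at h1
    have h2 : (R.image (Function.invFun σ)).card ≤ R.card := Finset.card_image_le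
    -- With `c = #R - χ(G) ≥ 1`, `3#R < 5s + 2 + 3c ≤ 5(s + c) ≤ 5χ(T)`, where `T` is the
    -- transversal. This is where the constant 2 in the bound on `χ(G)` is used up.
    obtain ⟨v, -, hv⟩ := exists_chiOn_le_chiOn_neighborSet_add_one (G := G)
      (R.image (Function.invFun σ)) (by omega)
    have h3 := chiOn_mono (G := G) (Set.inter_subset_right
      (s := ((R.image (Function.invFun σ) : Finset V) : Set V)) (t := G.neighborSet v))
    obtain ⟨u, hu⟩ : (G.neighborSet v).Nonempty := by
      rw [Set.nonempty_iff_ne_empty]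
      intro h
      have h6 : 1 ≤ chiOn G (G.neighborSet v) := by omega
      rw [h, chiOn_empty] at h6
      omega
    have h4 := hco' v u (Ne.symm hu.ne)
    have h5 := chiOn_mono (G := G) (Set.subset_union_right (s := {u}) (t := G.neighborSet v))
    omega
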